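/- Let $K,d,N\ge 1$ with $d\ge K-1$, and let $S_1,\dots,S_N\subseteq[K]=\{1,\dots,K\}$ be nonempty proper subsets (the label sets of $N$ samples). Let $M=\max_i|S_i|$, and assume that the data are balanced within each multiplicity: for every $m\in\{1,\dots,M\}$ the number $|\{i: S_i=T\}|$ is the same (possibly $0$) for all $T\subseteq[K]$ with $|T|=m$. Let $\lambda_W,\lambda_H>0$ and $\lambda_b\ge 0$. For $W\in\mathbb R^{K\times d}$ with rows $w^1,\dots,w^K$ (regarded as vectors in $\mathbb R^d$), $H=[h_1,\dots,h_N]\in\mathbb R^{d\times N}$ and $b\in\mathbb R^K$ put $$f(W,H,b)=\frac1N\sum_{i=1}^N\ \sum_{k\in S_i}-\log\frac{\exp\big((Wh_i+b)_k\big)}{\sum_{\ell=1}^K\exp\big((Wh_i+b)_\ell\big)}+\lambda_W\|W\|_F^2+\lambda_H\|H\|_F^2+\lambda_b\|b\|_2^2 .$$ Let $(W,H,b)$ be any global minimizer of $f$. Then: (1) $\|w^1\|_2=\dots=\|w^K\|_2=:w$, and $b=\beta\mathbf 1$ for some $\beta\in\mathbb R$, where $\beta=0$ or $\lambda_b=0$.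 (2) If $W\neq 0$, then $w>0$ and $W^\top$ forms a $K$-simplex ETF up to scaling and rotation: for every $U\in\mathbb R^{d\times d}$ with $U^\top U=I_d$, the matrix $Q=\frac1w UW^\top$ satisfies $$Q^\top Q=\frac{K}{K-1}\Big(I_K-\frac1K\mathbf 1\mathbf 1^\top\Big).$$ (3) (Tag-wise average property.) There are positive reals $C_1,\dots,C_M$ such that, for every $i$, $h_i=C_1w^k$ if $S_i=\{k\}$, and $h_i=C_m\sum_{k\in S_i}w^k$ if $|S_i|=m>1$. If $W\ne 0$, then $C_m$ is uniquely determined for every multiplicity $m$ that occurs in the data. -/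

import Mathlib

noncomputable section

namespace MLabNC

/-- Cross-entropy loss of the logits `z` against the one-hot label of class `k`. -/
def ceLoss {K : ℕ} (z : Fin K → ℝ) (k : Fin K) : ℝ :=
  -Real.log (Real.exp (z k) / ∑ l, Real.exp (z l))

/-- Pick-all-labels cross-entropy loss of the logits `z` against the label set `S`. -/
def palLoss {K : ℕ} (z : Fin K → ℝ) (S : Finset (Fin K)) : ℝ :=
  ∑ k ∈ S, ceLoss z k

/-- Squared Frobenius norm. -/
def frobSq {m n : ℕ} (A : Matrix (Fin m) (Fin n) ℝ) : ℝ :=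
  ∑ i, ∑ j, A i j ^ 2

/-- The data term: the average pick-all-labels loss of the logits `W hᵢ + b`,
where `hᵢ` is the `i`-th column of `H`. -/
def dataLoss {K d N : ℕ} (S : Fin N → Finset (Fin K)) (W : Matrix (Fin K) (Fin d) ℝ)
    (H : Matrix (Fin d) (Fin N) ℝ) (b : Fin K → ℝ) : ℝ :=
  (1 / (N : ℝ)) * ∑ i, palLoss (fun k => (W * H) k i + b k) (S i)

/-- The training objective of the unconstrained feature model. -/
def ufmLoss {K d N : ℕ} (S : Fin N → Finset (Fin K)) (lamW lamH lamb : ℝ)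
    (W : Matrix (Fin K) (Fin d) ℝ) (H : Matrix (Fin d) (Fin N) ℝ) (b : Fin K → ℝ) : ℝ :=
  dataLoss S W H b + lamW * frobSq W + lamH * frobSq H + lamb * ∑ k, b k ^ 2

/-- `(W, H, b)` is a global minimizer of the training objective. -/
def IsGlobalMin {K d N : ℕ} (S : Fin N → Finset (Fin K)) (lamW lamH lamb : ℝ)
    (W : Matrix (Fin K) (Fin d) ℝ) (H : Matrix (Fin d) (Fin N) ℝ) (b : Fin K → ℝ) : Prop :=
  ∀ (W' : Matrix (Fin K) (Fin d) ℝ) (H' : Matrix (Fin d) (Fin N) ℝ) (b' : Fin K → ℝ),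
    ufmLoss S lamW lamH lamb W H b ≤ ufmLoss S lamW lamH lamb W' H' b'

/-- Number of samples whose label set is exactly `T`. -/
def labelCount {K N : ℕ} (S : Fin N → Finset (Fin K)) (T : Finset (Fin K)) : ℕ :=
  (Finset.univ.filter (fun i => S i = T)).card

/-- The largest multiplicity occurring in the data. -/
def maxMultiplicity {K N : ℕ} (S : Fin N → Finset (Fin K)) : ℕ :=
  Finset.univ.sup (fun i => (S i).card)

/-- Balancedness within each multiplicity: for each `m` between `1` and the largest multiplicity,
all label sets of size `m` are carried by the same number (possibly `0`) of samples. -/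
def BalancedWithinMultiplicity {K N : ℕ} (S : Fin N → Finset (Fin K)) : Prop :=
  ∀ m : ℕ, 1 ≤ m → m ≤ maxMultiplicity S →
    ∃ n : ℕ, ∀ T : Finset (Fin K), T.card = m → labelCount S T = n

/-- Euclidean norm of the `k`-th row `w^k` of `W`. -/
def rowNorm {K d : ℕ} (W : Matrix (Fin K) (Fin d) ℝ) (k : Fin K) : ℝ :=
  ‖WithLp.toLp 2 (W k)‖

/-- Tag-wise average property with coefficients `C`: the feature of a sample of multiplicity `m`
is `C m` times the sum of the classifier rows of its labels. -/
def TagwiseAverage {K d N : ℕ} (S : Fin N → Finset (Fin K)) (W : Matrix (Fin K) (Fin d) ℝ)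
    (H : Matrix (Fin d) (Fin N) ℝ) (C : ℕ → ℝ) : Prop :=
  (∀ (i : Fin N) (k : Fin K), S i = {k} → H.col i = C 1 • W.row k) ∧
  (∀ (i : Fin N) (m : ℕ), 1 < m → (S i).card = m → H.col i = C m • ∑ k ∈ S i, W.row k)

end MLabNC

end

namespace MLabNC

/-! ### Convexity of the cross-entropy loss -/

/-! The loss is not convex in `(W, H)`, but near its minimizers it can be treated as if it were. At
a minimizer the rows of `W` sum to zero, so they span at most `K - 1 ≤ d` dimensions. Two such
parameter triples can be stacked with weights `1/√2` and compressed back to width `d`: the logits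
average, and the penalties do not exceed their averages (`exists_factorization_of_colSum_eq_zero`).
Strict convexity of cross-entropy modulo constant shifts then makes minimizers agree on the loss of
every sample at every label (`IsGlobalMin.ceLoss_eq_of_ufmLoss_eq`).

By balance, a permutation of labels lifts to one of samples and carries minimizers to minimizers. So
these losses depend only on multiplicity and membership, and gradients and logits are label
indicators up to scaling and constants (`IsGlobalMin.exists_gradient_profile`). Stationarity in `H`
gives the tag-wise formula, stationarity in `b` gives `lamb * b k = 0`, and averaging logits over
samples makes `b` constant. Finally `W * W.transpose` maps each label indicator into its span with
the all-ones vector; summing against centred indicators determines it up to a scalar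
(`exists_gram_eq`). -/

lemma sum_exp_pos {K : ℕ} (z : Fin K → ℝ) (k : Fin K) : 0 < ∑ l, Real.exp (z l) :=
  Finset.sum_pos (fun _ _ => Real.exp_pos _) ⟨k, Finset.mem_univ k⟩

lemma ceLoss_eq {K : ℕ} (z : Fin K → ℝ) (k : Fin K) :
    ceLoss z k = Real.log (∑ l, Real.exp (z l)) - z k := by
  rw [ceLoss, Real.log_div (Real.exp_pos _).ne' (sum_exp_pos z k).ne', Real.log_exp]
  ring

lemma exp_neg_ceLoss {K : ℕ} (z : Fin K → ℝ) (k : Fin K) :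
    Real.exp (-ceLoss z k) = Real.exp (z k) / ∑ l, Real.exp (z l) := by
  rw [ceLoss, neg_neg, Real.exp_log (div_pos (Real.exp_pos _) (sum_exp_pos z k))]

lemma sum_exp_neg_ceLoss {K : ℕ} (z : Fin K → ℝ) (k : Fin K) :
    ∑ l, Real.exp (-ceLoss z l) = 1 := by
  simp_rw [exp_neg_ceLoss, ← Finset.sum_div]
  exact div_self (sum_exp_pos z k).ne'

lemma ceLoss_add_const {K : ℕ} (z : Fin K → ℝ) (c : ℝ) (k : Fin K) :
    ceLoss (fun l => z l + c) k = ceLoss z k := by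
  simp only [ceLoss, Real.exp_add, ← Finset.sum_mul]
  rw [mul_div_mul_right _ _ (Real.exp_pos c).ne']

lemma ceLoss_comp_perm {K : ℕ} (z : Fin K → ℝ) (π : Equiv.Perm (Fin K)) (k : Fin K) :
    ceLoss (z ∘ π) k = ceLoss z (π k) := by
  simp only [ceLoss, Function.comp]
  rw [Equiv.sum_comp π (fun l => Real.exp (z l))]

/-- With softmax vectors `p = exp (-ceLoss z)` and `q` likewise for `z'`, the convexity gap is `log
∑ √(p q)`. It is the same for every label, so strictness follows once `p` and `q` differ anywhere.
-/
lemma ceLoss_midpoint_eq {K : ℕ} (z z' : Fin K → ℝ) (k : Fin K) :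
    ceLoss (fun l => (z l + z' l) / 2) k = (ceLoss z k + ceLoss z' k) / 2 +
      Real.log (∑ l, Real.exp ((-ceLoss z l + -ceLoss z' l) / 2)) := by
  set A := Real.log (∑ l, Real.exp (z l))
  set B := Real.log (∑ l, Real.exp (z' l))
  have h : ∑ l, Real.exp ((-ceLoss z l + -ceLoss z' l) / 2) =
      (∑ l, Real.exp ((z l + z' l) / 2)) * Real.exp (-(A + B) / 2) := by
    rw [Finset.sum_mul]
    refine Finset.sum_congr rfl fun l _ => ?_
    rw [← Real.exp_add, ceLoss_eq, ceLoss_eq]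
    congr 1
    ring
  rw [h, Real.log_mul (sum_exp_pos _ k).ne' (Real.exp_pos _).ne', Real.log_exp,
    ceLoss_eq, ceLoss_eq, ceLoss_eq]
  ring

lemma exp_midpoint_le (x y : ℝ) : Real.exp ((x + y) / 2) ≤ (Real.exp x + Real.exp y) / 2 := by
  have hx : Real.exp x = Real.exp (x / 2) ^ 2 := by rw [← Real.exp_nat_mul]; congr 1; push_cast; ring
  have hy : Real.exp y = Real.exp (y / 2) ^ 2 := by rw [← Real.exp_nat_mul]; congr 1; push_cast; ring
  rw [add_div, Real.exp_add, hx, hy]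
  nlinarith [sq_nonneg (Real.exp (x / 2) - Real.exp (y / 2))]

lemma exp_midpoint_lt {x y : ℝ} (h : x ≠ y) :
    Real.exp ((x + y) / 2) < (Real.exp x + Real.exp y) / 2 := by
  have hx : Real.exp x = Real.exp (x / 2) ^ 2 := by rw [← Real.exp_nat_mul]; congr 1; push_cast; ring
  have hy : Real.exp y = Real.exp (y / 2) ^ 2 := by rw [← Real.exp_nat_mul]; congr 1; push_cast; ring
  have hne : Real.exp (x / 2) - Real.exp (y / 2) ≠ 0 := by
    intro h0
    apply h
    have := Real.exp_injective (sub_eq_zero.1 h0)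
    linarith
  rw [add_div, Real.exp_add, hx, hy]
  nlinarith [pow_pos (sq_pos_of_ne_zero hne) 1]

lemma ceLoss_midpoint_le {K : ℕ} (z z' : Fin K → ℝ) (k : Fin K) :
    ceLoss (fun l => (z l + z' l) / 2) k ≤ (ceLoss z k + ceLoss z' k) / 2 := by
  rw [ceLoss_midpoint_eq]
  have : ∑ l, Real.exp ((-ceLoss z l + -ceLoss z' l) / 2) ≤ 1 := by
    calc _ ≤ ∑ l, (Real.exp (-ceLoss z l) + Real.exp (-ceLoss z' l)) / 2 :=
          Finset.sum_le_sum fun l _ => exp_midpoint_le _ _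
      _ = 1 := by
          rw [← Finset.sum_div, Finset.sum_add_distrib, sum_exp_neg_ceLoss z k,
            sum_exp_neg_ceLoss z' k]
          norm_num
  linarith [Real.log_nonpos (sum_exp_pos (fun l => (-ceLoss z l + -ceLoss z' l) / 2) k).le this]

lemma ceLoss_midpoint_lt {K : ℕ} (z z' : Fin K → ℝ) (k l : Fin K)
    (h : ceLoss z l ≠ ceLoss z' l) :
    ceLoss (fun l => (z l + z' l) / 2) k < (ceLoss z k + ceLoss z' k) / 2 := by
  rw [ceLoss_midpoint_eq]
  have : ∑ l, Real.exp ((-ceLoss z l + -ceLoss z' l) / 2) < 1 := by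
    calc _ < ∑ l, (Real.exp (-ceLoss z l) + Real.exp (-ceLoss z' l)) / 2 :=
          Finset.sum_lt_sum (fun l _ => exp_midpoint_le _ _)
            ⟨l, Finset.mem_univ l, exp_midpoint_lt fun h' => h (neg_injective h')⟩
      _ = 1 := by
          rw [← Finset.sum_div, Finset.sum_add_distrib, sum_exp_neg_ceLoss z k,
            sum_exp_neg_ceLoss z' k]
          norm_num
  linarith [Real.log_neg (sum_exp_pos (fun l => (-ceLoss z l + -ceLoss z' l) / 2) k) this]

lemma palLoss_midpoint_le {K : ℕ} (z z' : Fin K → ℝ) (T : Finset (Fin K)) :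
    palLoss (fun l => (z l + z' l) / 2) T ≤ (palLoss z T + palLoss z' T) / 2 := by
  unfold palLoss
  rw [← Finset.sum_add_distrib, Finset.sum_div]
  exact Finset.sum_le_sum fun k _ => ceLoss_midpoint_le z z' k

lemma palLoss_midpoint_lt {K : ℕ} (z z' : Fin K → ℝ) {T : Finset (Fin K)} (hT : T.Nonempty)
    (l : Fin K) (h : ceLoss z l ≠ ceLoss z' l) :
    palLoss (fun l => (z l + z' l) / 2) T < (palLoss z T + palLoss z' T) / 2 := by
  unfold palLoss
  rw [← Finset.sum_add_distrib, Finset.sum_div]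
  exact Finset.sum_lt_sum_of_nonempty hT fun k _ => ceLoss_midpoint_lt z z' k l h

lemma palLoss_add_const {K : ℕ} (z : Fin K → ℝ) (c : ℝ) (T : Finset (Fin K)) :
    palLoss (fun l => z l + c) T = palLoss z T := by
  simp only [palLoss, ceLoss_add_const]

lemma palLoss_comp_perm {K : ℕ} (z : Fin K → ℝ) (π : Equiv.Perm (Fin K)) (T : Finset (Fin K)) :
    palLoss (z ∘ π) T = palLoss z (T.map π.toEmbedding) := by
  simp [palLoss, ceLoss_comp_perm]

lemma hasDerivAt_palLoss_line {K : ℕ} (z v : Fin K → ℝ) (T : Finset (Fin K)) (hT : T.Nonempty) :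
    HasDerivAt (fun t : ℝ => palLoss (fun k => z k + t * v k) T)
      (-∑ k, ((if k ∈ T then 1 else 0) - T.card * Real.exp (-ceLoss z k)) * v k) 0 := by
  obtain ⟨k₀, -⟩ := hT
  have hlin : ∀ k, HasDerivAt (fun t : ℝ => z k + t * v k) (v k) 0 := fun k => by
    simpa using ((hasDerivAt_id (0 : ℝ)).mul_const (v k)).const_add (z k)
  have hsum : HasDerivAt (fun t : ℝ => ∑ l, Real.exp (z l + t * v l))
      (∑ l, Real.exp (z l) * v l) 0 := by
    refine HasDerivAt.fun_sum fun l _ => ?_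
    simpa using (hlin l).exp
  have hlog : HasDerivAt (fun t : ℝ => Real.log (∑ l, Real.exp (z l + t * v l)))
      (∑ l, Real.exp (-ceLoss z l) * v l) 0 := by
    have h := hsum.log (by simpa using (sum_exp_pos z k₀).ne')
    convert h using 1
    simp only [zero_mul, add_zero, exp_neg_ceLoss, Finset.sum_div]
    exact Finset.sum_congr rfl fun l _ => by ring
  have hce : HasDerivAt (fun t : ℝ => palLoss (fun k => z k + t * v k) T)
      (∑ k ∈ T, (∑ l, Real.exp (-ceLoss z l) * v l - v k)) 0 := by
    unfold palLoss
    refine HasDerivAt.fun_sum fun k _ => ?_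
    have h : (fun t : ℝ => ceLoss (fun k => z k + t * v k) k) = fun t : ℝ =>
        Real.log (∑ l, Real.exp (z l + t * v l)) - (z k + t * v k) := funext fun t => ceLoss_eq _ k
    rw [h]
    exact hlog.sub (hlin k)
  convert hce using 1
  rw [Finset.sum_sub_distrib, Finset.sum_const, nsmul_eq_mul]
  simp only [sub_mul, Finset.sum_sub_distrib, ite_mul, one_mul, zero_mul, Finset.sum_ite_mem,
    Finset.univ_inter, mul_assoc, ← Finset.mul_sum]
  ring

/-! ### Reduction of the hidden dimension -/

lemma exists_linearIsometry_of_finrank_le {E : Type*} [NormedAddCommGroup E]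
    [InnerProductSpace ℝ E] [FiniteDimensional ℝ E] {d : ℕ} (h : Module.finrank ℝ E ≤ d) :
    Nonempty (E →ₗᵢ[ℝ] EuclideanSpace ℝ (Fin d)) := by
  let v := stdOrthonormalBasis ℝ E
  let w : Fin (Module.finrank ℝ E) → EuclideanSpace ℝ (Fin d) :=
    fun j => EuclideanSpace.basisFun (Fin d) ℝ (Fin.castLE h j)
  have hw : Orthonormal ℝ w :=
    (EuclideanSpace.basisFun (Fin d) ℝ).orthonormal.comp _ (Fin.castLE_injective h)
  let f : E →ₗ[ℝ] EuclideanSpace ℝ (Fin d) := v.toBasis.constr ℝ w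
  refine ⟨f.isometryOfOrthonormal (v := v.toBasis) ?_ ?_⟩
  · simp [v.orthonormal]
  · convert hw using 1
    ext1 j
    simp only [Function.comp, f, Module.Basis.constr_basis]

/-- The row span has dimension at most `K - 1 ≤ d`, so it embeds isometrically in width `d`.
Projecting the columns of `H` onto it keeps their inner products with the rows and cannot increase
their norms. -/
lemma exists_factorization_of_colSum_eq_zero {K d N : ℕ} {ι : Type*} [Fintype ι]
    (hd : K ≤ d + 1) (W : Matrix (Fin K) ι ℝ) (H : Matrix ι (Fin N) ℝ)
    (hW : ∀ j, ∑ k, W k j = 0) :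
    ∃ (W' : Matrix (Fin K) (Fin d) ℝ) (H' : Matrix (Fin d) (Fin N) ℝ),
      W' * H' = W * H ∧ frobSq W' = ∑ k, ∑ j, W k j ^ 2 ∧ frobSq H' ≤ ∑ j, ∑ i, H j i ^ 2 := by
  classical
  let r : Fin K → EuclideanSpace ℝ ι := fun k => WithLp.toLp 2 (W k)
  let c : Fin N → EuclideanSpace ℝ ι := fun i => WithLp.toLp 2 (fun j => H j i)
  let E : Submodule ℝ (EuclideanSpace ℝ ι) := Submodule.span ℝ (Set.range r)
  have hr : ∑ k, r k = 0 := by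
    ext j
    simp only [r, WithLp.ofLp_sum, PiLp.zero_apply]
    exact (Finset.sum_apply j _ _).trans (hW j)
  have hfin : Module.finrank ℝ E ≤ d := by
    by_contra hlt
    have hle : Module.finrank ℝ E ≤ K := by
      simpa [E, Set.finrank] using finrank_range_le_card (R := ℝ) r
    have hli : LinearIndependent ℝ r := by
      rw [linearIndependent_iff_card_eq_finrank_span]
      simp only [Fintype.card_fin]
      change K = Module.finrank ℝ E
      omega
    have h0 := Fintype.linearIndependent_iff.1 hli (fun _ => 1) (by simpa using hr)
    exact absurd (h0 ⟨0, by omega⟩) one_ne_zero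
  obtain ⟨L⟩ := exists_linearIsometry_of_finrank_le hfin
  have hrE : ∀ k, r k ∈ E := fun k => Submodule.subset_span ⟨k, rfl⟩
  let p : Fin N → E := fun i => E.orthogonalProjectionOnto (c i)
  refine ⟨Matrix.of fun k j => L ⟨r k, hrE k⟩ j, Matrix.of fun j i => L (p i) j, ?_, ?_, ?_⟩
  · ext k i
    have h1 : inner ℝ (L ⟨r k, hrE k⟩) (L (p i)) = inner ℝ (r k) (c i) := by
      rw [L.inner_map_map]
      exact Submodule.inner_orthogonalProjectionOnto_eq_of_mem_left ⟨r k, hrE k⟩ (c i)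
    simp only [PiLp.inner_apply, RCLike.inner_apply, conj_trivial] at h1
    simp only [Matrix.mul_apply, Matrix.of_apply]
    simp only [r, c] at h1
    rw [show ∑ j, W k j * H j i = ∑ j, H j i * W k j from
      Finset.sum_congr rfl fun _ _ => mul_comm _ _, ← h1]
    exact Finset.sum_congr rfl fun _ _ => mul_comm _ _
  · refine Finset.sum_congr rfl fun k _ => ?_
    have h1 : ‖L ⟨r k, hrE k⟩‖ ^ 2 = ‖r k‖ ^ 2 := by
      rw [L.norm_map]
      rfl
    rw [EuclideanSpace.real_norm_sq_eq, EuclideanSpace.real_norm_sq_eq] at h1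
    exact h1
  · unfold frobSq
    rw [Finset.sum_comm, Finset.sum_comm (γ := ι)]
    refine Finset.sum_le_sum fun i _ => ?_
    have h1 : ‖L (p i)‖ ^ 2 ≤ ‖c i‖ ^ 2 := by
      rw [L.norm_map]
      gcongr
      exact E.norm_orthogonalProjectionOnto_apply_le (c i)
    rw [EuclideanSpace.real_norm_sq_eq, EuclideanSpace.real_norm_sq_eq] at h1
    exact h1


/-! ### Properties of global minimizers -/

section Minimizer

variable {K d N : ℕ} {S : Fin N → Finset (Fin K)} {lamW lamH lamb : ℝ}
  {W : Matrix (Fin K) (Fin d) ℝ} {H : Matrix (Fin d) (Fin N) ℝ} {b : Fin K → ℝ}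

/-- Removing the mean of the rows of the classifier lowers its norm and keeps the data loss. -/
lemma IsGlobalMin.colSum_eq_zero (hW : 0 < lamW) (hmin : IsGlobalMin S lamW lamH lamb W H b)
    (j : Fin d) : ∑ k, W k j = 0 := by
  rcases Nat.eq_zero_or_pos K with rfl | hK
  · simp
  have hK' : (0 : ℝ) < K := by exact_mod_cast hK
  set μ : Fin d → ℝ := fun j => (∑ k, W k j) / K
  have hμ : ∀ j, ∑ k, W k j = K * μ j := fun j => by
    simp only [μ]
    field_simp
  have h := hmin (Matrix.of fun k j => W k j - μ j) H b
  have hdata : dataLoss S (Matrix.of fun k j => W k j - μ j) H b = dataLoss S W H b := by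
    unfold dataLoss
    congr 1
    refine Finset.sum_congr rfl fun i _ => ?_
    rw [← palLoss_add_const (fun k => (W * H) k i + b k) (-∑ j, μ j * H j i)]
    congr 1
    ext k
    simp only [Matrix.mul_apply, Matrix.of_apply, sub_mul, Finset.sum_sub_distrib]
    ring
  have hfrob : frobSq (Matrix.of fun k j => W k j - μ j) = frobSq W - K * ∑ j, μ j ^ 2 := by
    unfold frobSq
    rw [Finset.sum_comm, Finset.sum_comm (f := fun k j => W k j ^ 2), Finset.mul_sum,
      ← Finset.sum_sub_distrib]
    refine Finset.sum_congr rfl fun j _ => ?_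
    simp only [Matrix.of_apply, sub_sq, Finset.sum_add_distrib, Finset.sum_sub_distrib,
      ← Finset.sum_mul, ← Finset.mul_sum, hμ]
    simp
    ring
  unfold ufmLoss at h
  rw [hdata, hfrob] at h
  have h0 : lamW * K * ∑ j, μ j ^ 2 ≤ 0 := by linarith
  have h1 : ∑ j, μ j ^ 2 ≤ 0 := nonpos_of_mul_nonpos_right h0 (mul_pos hW hK')
  have h2 := (Finset.sum_eq_zero_iff_of_nonneg fun j _ => sq_nonneg (μ j)).1
    (le_antisymm h1 (Finset.sum_nonneg fun j _ => sq_nonneg (μ j))) j (Finset.mem_univ j)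
  rw [hμ, pow_eq_zero_iff two_ne_zero |>.1 h2, mul_zero]

/-- Two centred parameter triples with the minimal loss have the same loss on every sample. -/
lemma IsGlobalMin.ceLoss_eq_of_ufmLoss_eq (hN : 0 < N) (hd : K ≤ d + 1)
    (hne : ∀ i, (S i).Nonempty) (hlH : 0 < lamH) (hlb : 0 ≤ lamb)
    (hmin : IsGlobalMin S lamW lamH lamb W H b)
    {W' : Matrix (Fin K) (Fin d) ℝ} {H' : Matrix (Fin d) (Fin N) ℝ} {b' : Fin K → ℝ}
    (hW : ∀ j, ∑ k, W k j = 0) (hW' : ∀ j, ∑ k, W' k j = 0)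
    (heq : ufmLoss S lamW lamH lamb W' H' b' = ufmLoss S lamW lamH lamb W H b)
    (i : Fin N) (k : Fin K) :
    ceLoss (fun k => (W' * H') k i + b' k) k = ceLoss (fun k => (W * H) k i + b k) k := by
  by_contra hk
  have hN' : (0 : ℝ) < 1 / N := by positivity
  have hs : (√2)⁻¹ ^ 2 = (1 / 2 : ℝ) := by rw [inv_pow, Real.sq_sqrt zero_le_two]; norm_num
  -- The factors `1/√2` make the product of the stacked matrices the mean of `W' * H'` and `W * H`,
  -- and their squared norms the means of the two penalties.
  obtain ⟨V, G, hVG, hV, hG⟩ := exists_factorization_of_colSum_eq_zero hd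
    ((√2)⁻¹ • Matrix.fromCols W' W) ((√2)⁻¹ • Matrix.fromRows H' H) (by
      rintro (j | j)
      · simp [← Finset.mul_sum, hW' j]
      · simp [← Finset.mul_sum, hW j])
  have h := hmin V G (fun k => (b' k + b k) / 2)
  have hV' : frobSq V = (frobSq W' + frobSq W) / 2 := by
    rw [hV]
    simp only [frobSq, Fintype.sum_sum_type, Matrix.smul_apply, Matrix.fromCols_apply_inl,
      Matrix.fromCols_apply_inr, smul_eq_mul, mul_pow, hs, ← Finset.mul_sum,
      Finset.sum_add_distrib]
    ring
  have hG' : frobSq G ≤ (frobSq H' + frobSq H) / 2 := by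
    refine hG.trans_eq ?_
    simp only [frobSq, Fintype.sum_sum_type, Matrix.smul_apply, Matrix.fromRows_apply_inl,
      Matrix.fromRows_apply_inr, smul_eq_mul, mul_pow, hs, ← Finset.mul_sum]
    ring
  have hlogit : ∀ i, (fun k => (V * G) k i + (b' k + b k) / 2) = fun k =>
      (((W' * H') k i + b' k) + ((W * H) k i + b k)) / 2 := by
    intro i
    ext k
    rw [hVG, Matrix.smul_mul, Matrix.mul_smul, smul_smul, Matrix.fromCols_mul_fromRows, ← sq, hs]
    simp only [Matrix.smul_apply, Matrix.add_apply, smul_eq_mul]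
    ring
  have hdata : dataLoss S V G (fun k => (b' k + b k) / 2) <
      (dataLoss S W' H' b' + dataLoss S W H b) / 2 := by
    unfold dataLoss
    rw [← mul_add, ← Finset.sum_add_distrib, mul_div_assoc, Finset.sum_div]
    refine mul_lt_mul_of_pos_left ?_ hN'
    simp only [hlogit]
    exact Finset.sum_lt_sum (fun i _ => palLoss_midpoint_le _ _ _)
      ⟨i, Finset.mem_univ i, palLoss_midpoint_lt _ _ (hne i) k hk⟩
  have hbias : ∑ k, ((b' k + b k) / 2) ^ 2 ≤ (∑ k, b' k ^ 2 + ∑ k, b k ^ 2) / 2 := by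
    rw [← Finset.sum_add_distrib, Finset.sum_div]
    exact Finset.sum_le_sum fun k _ => by nlinarith [sq_nonneg (b' k - b k)]
  unfold ufmLoss at h heq
  rw [hV'] at h
  nlinarith [mul_le_mul_of_nonneg_left hG' hlH.le, mul_le_mul_of_nonneg_left hbias hlb]

/-- Stationarity of a global minimizer along a line in the features and the bias. -/
lemma IsGlobalMin.stationary (hN : 0 < N) (hne : ∀ i, (S i).Nonempty)
    (hmin : IsGlobalMin S lamW lamH lamb W H b)
    (D : Matrix (Fin d) (Fin N) ℝ) (e : Fin K → ℝ) :
    ∑ i, ∑ k, ((if k ∈ S i then 1 else 0) -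
        (S i).card * Real.exp (-ceLoss (fun k => (W * H) k i + b k) k)) * ((W * D) k i + e k) =
      2 * N * (lamH * ∑ j, ∑ i, H j i * D j i + lamb * ∑ k, b k * e k) := by
  have hN' : (N : ℝ) ≠ 0 := by positivity
  have hlin : ∀ x y : ℝ, HasDerivAt (fun t : ℝ => (x + t * y) ^ 2) (2 * (x * y)) 0 := fun x y => by
    have hl : HasDerivAt (fun t : ℝ => x + t * y) y 0 := by
      simpa using ((hasDerivAt_id (0 : ℝ)).mul_const y).const_add x
    simpa [mul_assoc] using hl.fun_pow 2
  have hdata := (HasDerivAt.fun_sum (u := Finset.univ) fun (i : Fin N) _ =>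
    hasDerivAt_palLoss_line (fun k => (W * H) k i + b k) (fun k => (W * D) k i + e k) (S i)
      (hne i)).const_mul (1 / (N : ℝ))
  have hfrob : HasDerivAt (fun t : ℝ => frobSq (H + t • D)) (∑ j, ∑ i, 2 * (H j i * D j i)) 0 :=
    HasDerivAt.fun_sum fun j _ => HasDerivAt.fun_sum fun i _ => hlin _ _
  have hbias : HasDerivAt (fun t : ℝ => ∑ k, (b k + t * e k) ^ 2) (∑ k, 2 * (b k * e k)) 0 :=
    HasDerivAt.fun_sum fun k _ => hlin _ _
  have hderiv := ((hdata.add_const (lamW * frobSq W)).add (hfrob.const_mul lamH)).add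
    (hbias.const_mul lamb)
  have hloc : IsLocalMin (fun t : ℝ =>
      ufmLoss S lamW lamH lamb W (H + t • D) (fun k => b k + t * e k)) 0 := by
    refine Filter.Eventually.of_forall fun t => ?_
    simpa using hmin W (H + t • D) (fun k => b k + t * e k)
  have hfun : (fun t : ℝ => ufmLoss S lamW lamH lamb W (H + t • D) (fun k => b k + t * e k)) =
      fun t : ℝ => 1 / (N : ℝ) * (∑ i, palLoss (fun k => ((W * H) k i + b k) +
        t * ((W * D) k i + e k)) (S i)) + lamW * frobSq W + lamH * frobSq (H + t • D) +
        lamb * ∑ k, (b k + t * e k) ^ 2 := by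
    ext t
    unfold ufmLoss dataLoss
    congr 5
    ext i
    congr 1
    ext k
    rw [Matrix.mul_add, Matrix.mul_smul]
    simp only [Matrix.add_apply, Matrix.smul_apply, smul_eq_mul]
    ring
  rw [hfun] at hloc
  have h0 := hloc.hasDerivAt_eq_zero hderiv
  simp only [Finset.sum_neg_distrib, ← Finset.mul_sum] at h0
  field_simp at h0
  linarith

end Minimizer


/-! ### Balanced label sets -/

section Balanced

variable {K N : ℕ} {S : Fin N → Finset (Fin K)}

/-- The sizes outside the hypothesis are harmless: only one set has size zero, and no sample exceeds
the maximal multiplicity. -/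
lemma BalancedWithinMultiplicity.labelCount_eq (hbal : BalancedWithinMultiplicity S)
    {T T' : Finset (Fin K)} (h : T.card = T'.card) : labelCount S T = labelCount S T' := by
  rcases Nat.eq_zero_or_pos T.card with h0 | hpos
  · rw [Finset.card_eq_zero.1 h0, Finset.card_eq_zero.1 (h ▸ h0 : T'.card = 0)]
  rcases le_or_gt T.card (maxMultiplicity S) with hle | hlt
  · obtain ⟨n, hn⟩ := hbal T.card hpos hle
    rw [hn T rfl, hn T' h.symm]
  · have hzero : ∀ U : Finset (Fin K), U.card = T.card → labelCount S U = 0 := by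
      intro U hU
      refine Finset.card_eq_zero.2 (Finset.filter_eq_empty_iff.2 fun i _ hi => ?_)
      have : (S i).card ≤ maxMultiplicity S :=
        Finset.le_sup (f := fun i => (S i).card) (Finset.mem_univ i)
      rw [hi] at this
      omega
    rw [hzero T rfl, hzero T' h.symm]

/-- A permutation of the labels lifts to a permutation of the samples of balanced data. -/
lemma BalancedWithinMultiplicity.exists_samplePerm (hbal : BalancedWithinMultiplicity S)
    (π : Equiv.Perm (Fin K)) :
    ∃ σ : Equiv.Perm (Fin N), ∀ j, S (σ j) = (S j).map π.toEmbedding := by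
  have hmap : ∀ U T : Finset (Fin K),
      U.map π.toEmbedding = T ↔ U = T.map π.symm.toEmbedding := by
    intro U T
    constructor
    · rintro rfl
      ext x
      simp
    · rintro rfl
      ext x
      simp
  have hcard : ∀ T : Finset (Fin K), Nonempty
      ({j // (S j).map π.toEmbedding = T} ≃ {j // S j = T}) := by
    intro T
    rw [← Fintype.card_eq, Fintype.card_subtype, Fintype.card_subtype]
    simp only [hmap]
    exact hbal.labelCount_eq (Finset.card_map _)
  -- Bijections between the fibres of `j ↦ π (S j)` and of `S` over each `T` glue to a permutation.
  exact ⟨Equiv.ofFiberEquiv fun T => (hcard T).some, Equiv.ofFiberEquiv_map _⟩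

lemma BalancedWithinMultiplicity.exists_samplePerm_apply_eq (hbal : BalancedWithinMultiplicity S)
    (π : Equiv.Perm (Fin K)) {i i' : Fin N} (h : S i' = (S i).map π.toEmbedding) :
    ∃ σ : Equiv.Perm (Fin N), σ i = i' ∧ ∀ j, S (σ j) = (S j).map π.toEmbedding := by
  obtain ⟨σ, hσ⟩ := hbal.exists_samplePerm π
  -- The samples `σ i` and `i'` carry the same label set, so exchanging them is free.
  refine ⟨σ.trans (Equiv.swap (σ i) i'), by simp, fun j => ?_⟩
  rw [← hσ j, Equiv.trans_apply, Equiv.swap_apply_def]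
  split_ifs with h1 h2
  · rw [h, h1, hσ]
  · rw [h2, h, hσ]
  · rfl

lemma exists_perm_map_eq {T T' : Finset (Fin K)} (h : T.card = T'.card) {k k' : Fin K}
    (hk : k ∈ T ↔ k' ∈ T') :
    ∃ π : Equiv.Perm (Fin K), T.map π.toEmbedding = T' ∧ π k = k' := by
  obtain ⟨π, hπ⟩ : ∃ π : Equiv.Perm (Fin K), ∀ x, π x ∈ T' ↔ x ∈ T := by
    let e : {x // x ∈ T} ≃ {x // x ∈ T'} := Finset.equivOfCardEq h
    refine ⟨e.extendSubtype, fun x => ⟨fun hx => ?_, e.extendSubtype_mem x⟩⟩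
    by_contra hxT
    exact e.extendSubtype_not_mem x hxT hx
  -- The transposition preserves `T'`, since `π k` and `k'` are both in it or both outside.
  refine ⟨π.trans (Equiv.swap (π k) k'), ?_, by simp⟩
  refine Finset.eq_of_subset_of_card_le ?_ (by simp [h])
  intro y hy
  obtain ⟨x, hx, rfl⟩ := Finset.mem_map.1 hy
  simp only [Equiv.coe_toEmbedding, Equiv.trans_apply, Equiv.swap_apply_def]
  have hx' := (hπ x).2 hx
  split_ifs with h1 h2
  · rwa [← hk, ← π.injective h1]
  · rwa [hπ, hk, ← h2]
  · exact hx'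

/-- The centred indicator `K • 1_S - |S|` of a label set. -/
def centredIndicator (S : Finset (Fin K)) (k : Fin K) : ℝ :=
  K * (if k ∈ S then 1 else 0) - S.card

lemma sum_centredIndicator (T : Finset (Fin K)) : ∑ k, centredIndicator T k = 0 := by
  simp [centredIndicator, mul_comm]

lemma centredIndicator_map (T : Finset (Fin K)) (π : Equiv.Perm (Fin K)) (k : Fin K) :
    centredIndicator (T.map π.toEmbedding) (π k) = centredIndicator T k := by
  simp [centredIndicator]

lemma eq_zero_of_forall_eq_of_sum_eq_zero {q : Fin K → ℝ} (h : ∀ k l, q k = q l)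
    (hs : ∑ k, q k = 0) (k : Fin K) : q k = 0 := by
  have hK : (K : ℝ) ≠ 0 := by have := k.pos; positivity
  rw [Finset.sum_congr rfl fun l _ => h l k] at hs
  simpa [hK] using hs

/-- Lifting transpositions of labels to samples shows that the sum does not depend on `k`; its total
over `k` is zero. -/
lemma BalancedWithinMultiplicity.sum_centredIndicator_eq_zero
    (hbal : BalancedWithinMultiplicity S) (F : ℕ → ℝ) (k : Fin K) :
    ∑ i, F (S i).card * centredIndicator (S i) k = 0 := by
  refine eq_zero_of_forall_eq_of_sum_eq_zero
    (q := fun k => ∑ i, F (S i).card * centredIndicator (S i) k) (fun k l => ?_) ?_ k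
  · obtain ⟨σ, hσ⟩ := hbal.exists_samplePerm (Equiv.swap k l)
    rw [← Equiv.sum_comp σ]
    refine Finset.sum_congr rfl fun i _ => ?_
    rw [hσ, Finset.card_map, ← centredIndicator_map (S i) (Equiv.swap k l) l,
      Equiv.swap_apply_right]
  · rw [Finset.sum_comm]
    simp [← Finset.mul_sum, sum_centredIndicator]

/-- The weighted cross moments of the label indicators are those of a simplex. -/
lemma BalancedWithinMultiplicity.exists_sum_indicator_mul_centredIndicator
    (hbal : BalancedWithinMultiplicity S) (F : ℕ → ℝ) :
    ∃ t : ℝ, ∀ k l, ∑ i, F (S i).card * (if k ∈ S i then 1 else 0) * centredIndicator (S i) l =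
      t * (K * (if k = l then 1 else 0) - 1) := by
  rcases Nat.eq_zero_or_pos K with rfl | hK
  · exact ⟨0, fun k => k.elim0⟩
  set m : Fin K → Fin K → ℝ := fun k l =>
    ∑ i, F (S i).card * (if k ∈ S i then 1 else 0) * centredIndicator (S i) l with hm
  have hinv : ∀ (π : Equiv.Perm (Fin K)) k l, m (π k) (π l) = m k l := by
    intro π k l
    obtain ⟨σ, hσ⟩ := hbal.exists_samplePerm π
    simp only [hm]
    rw [← Equiv.sum_comp σ]
    refine Finset.sum_congr rfl fun i _ => ?_
    rw [hσ, Finset.card_map, centredIndicator_map]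
    simp
  have hsum : ∀ k, ∑ l, m k l = 0 := by
    intro k
    simp only [hm]
    rw [Finset.sum_comm]
    simp [← Finset.mul_sum, sum_centredIndicator]
  let k₀ : Fin K := ⟨0, hK⟩
  have hdiag : ∀ k, m k k = m k₀ k₀ := fun k => by
    simpa using hinv (Equiv.swap k₀ k) k₀ k₀
  have hoff : ∀ k l l', k ≠ l → k ≠ l' → m k l = m k l' := fun k l l' h h' => by
    have := hinv (Equiv.swap l l') k l
    rwa [Equiv.swap_apply_left, Equiv.swap_apply_of_ne_of_ne h h', eq_comm] at this
  have hrow : ∀ k l, k ≠ l → m k₀ k₀ + (K - 1) * m k l = 0 := by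
    intro k l hkl
    have h := hsum k
    rw [← Finset.add_sum_erase _ _ (Finset.mem_univ k), hdiag,
      Finset.sum_congr rfl fun l' hl' => hoff k l' l (Finset.ne_of_mem_erase hl').symm hkl,
      Finset.sum_const, Finset.card_erase_of_mem (Finset.mem_univ k), Finset.card_univ,
      Fintype.card_fin, nsmul_eq_mul, Nat.cast_sub hK, Nat.cast_one] at h
    exact h
  -- Invariance leaves one diagonal and one off-diagonal value, and zero row sums tie them together.
  -- For `K = 1` the quotient is a division by zero, but its factor `K - 1` vanishes, as does the
  -- single entry.
  refine ⟨m k₀ k₀ / (K - 1), fun k l => ?_⟩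
  change m k l = _
  by_cases hkl : k = l
  · subst hkl
    rw [hdiag, if_pos rfl, mul_one]
    rcases eq_or_ne (K : ℝ) 1 with h1 | h1
    · have h := hsum k₀
      have hK1 : K = 1 := by exact_mod_cast h1
      rw [h1, sub_self, mul_zero, ← h]
      refine (Finset.sum_eq_single_of_mem k₀ (Finset.mem_univ _) fun l _ hl => ?_).symm
      exact absurd (Fin.ext (by have := l.2; have := k₀.2; omega)) hl
    · rw [div_mul_cancel₀ _ (sub_ne_zero.2 h1)]
  · have hK1 : (K : ℝ) - 1 ≠ 0 := by
      have h2 : K ≠ 1 := by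
        rintro rfl
        exact hkl (Subsingleton.elim _ _)
      exact sub_ne_zero.2 (by exact_mod_cast h2)
    have h := hrow k l hkl
    rw [if_neg hkl]
    field_simp
    linarith

lemma BalancedWithinMultiplicity.exists_pos_sum_indicator_mul_centredIndicator
    (hbal : BalancedWithinMultiplicity S) (hN : 0 < N) (hne : ∀ i, (S i).Nonempty)
    (hproper : ∀ i, S i ≠ Finset.univ) :
    ∃ t : ℝ, 0 < t ∧ ∀ k l, ∑ i, (if k ∈ S i then 1 else 0) * centredIndicator (S i) l =
      t * (K * (if k = l then 1 else 0) - 1) := by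
  obtain ⟨t, ht⟩ := hbal.exists_sum_indicator_mul_centredIndicator fun _ => 1
  simp only [one_mul] at ht
  refine ⟨t, ?_, ht⟩
  obtain ⟨k, hk⟩ := hne ⟨0, hN⟩
  have hcard : ∀ i, ((S i).card : ℝ) < K := fun i => by
    have h := Finset.card_lt_card (Finset.ssubset_univ_iff.2 (hproper i))
    rw [Finset.card_univ, Fintype.card_fin] at h
    exact_mod_cast h
  have h1 : 0 < ∑ i, (if k ∈ S i then 1 else 0) * centredIndicator (S i) k := by
    refine Finset.sum_pos' (fun i _ => ?_) ⟨⟨0, hN⟩, Finset.mem_univ _, ?_⟩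
    · unfold centredIndicator
      split_ifs
      · linarith [hcard i]
      · simp
    · simp only [centredIndicator, hk, if_true]
      linarith [hcard ⟨0, hN⟩]
  rw [ht, if_pos rfl, mul_one] at h1
  have : (1 : ℝ) ≤ K := by exact_mod_cast k.pos
  exact pos_of_mul_pos_left h1 (by linarith)

end Balanced


/-! ### Structure of global minimizers on balanced data -/

section Structure

variable {K d N : ℕ} {S : Fin N → Finset (Fin K)} {lamW lamH lamb : ℝ}
  {W : Matrix (Fin K) (Fin d) ℝ} {H : Matrix (Fin d) (Fin N) ℝ} {b : Fin K → ℝ}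

lemma ufmLoss_submatrix_perm (π : Equiv.Perm (Fin K)) (σ : Equiv.Perm (Fin N))
    (hσ : ∀ j, S (σ j) = (S j).map π.toEmbedding) :
    ufmLoss S lamW lamH lamb (W.submatrix π id) (H.submatrix id σ) (b ∘ π) =
      ufmLoss S lamW lamH lamb W H b := by
  have hlogit : ∀ i, (fun k => (W.submatrix π id * H.submatrix id σ) k i + (b ∘ π) k) =
      (fun k => (W * H) k (σ i) + b k) ∘ π := fun i => by
    ext k
    simp [Matrix.mul_apply]
  unfold ufmLoss dataLoss frobSq
  simp only [hlogit, palLoss_comp_perm, ← hσ]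
  simp only [Matrix.submatrix_apply, id, Function.comp_apply]
  rw [Equiv.sum_comp σ fun i => palLoss (fun k => (W * H) k i + b k) (S i),
    Equiv.sum_comp π fun k => b k ^ 2, Equiv.sum_comp π fun k => ∑ j, W k j ^ 2]
  simp only [fun j => Equiv.sum_comp σ fun i => H j i ^ 2]

/-- At a global minimizer, the loss of a sample on a label depends only on the multiplicity of the
sample and on whether it carries the label. -/
lemma IsGlobalMin.ceLoss_eq_of_card_eq (hN : 0 < N) (hd : K ≤ d + 1)
    (hne : ∀ i, (S i).Nonempty) (hbal : BalancedWithinMultiplicity S)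
    (hlW : 0 < lamW) (hlH : 0 < lamH) (hlb : 0 ≤ lamb)
    (hmin : IsGlobalMin S lamW lamH lamb W H b) {i i' : Fin N} {k k' : Fin K}
    (hcard : (S i).card = (S i').card) (hk : k ∈ S i ↔ k' ∈ S i') :
    ceLoss (fun k => (W * H) k i + b k) k = ceLoss (fun k => (W * H) k i' + b k) k' := by
  -- Choose `π` taking `S i` to `S i'` and `k` to `k'`, and a lift taking `i` to `i'`. The permuted
  -- parameters attain the same minimum, so they have the same losses.
  obtain ⟨π, hπ, rfl⟩ := exists_perm_map_eq hcard hk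
  obtain ⟨σ, rfl, hσ⟩ := hbal.exists_samplePerm_apply_eq π hπ.symm
  have hcol := hmin.colSum_eq_zero hlW
  have h := hmin.ceLoss_eq_of_ufmLoss_eq hN hd hne hlH hlb hcol (W' := W.submatrix π id)
    (fun j => by simpa using (Equiv.sum_comp π fun k => W k j).trans (hcol j))
    (ufmLoss_submatrix_perm π σ hσ) i k
  rw [← h, ← ceLoss_comp_perm]
  congr 1

lemma IsGlobalMin.exists_ceLoss_profile (hN : 0 < N) (hd : K ≤ d + 1)
    (hne : ∀ i, (S i).Nonempty) (hproper : ∀ i, S i ≠ Finset.univ)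
    (hbal : BalancedWithinMultiplicity S)
    (hlW : 0 < lamW) (hlH : 0 < lamH) (hlb : 0 ≤ lamb)
    (hmin : IsGlobalMin S lamW lamH lamb W H b) :
    ∃ u v : ℕ → ℝ, ∀ i k, ceLoss (fun k => (W * H) k i + b k) k =
      if k ∈ S i then u (S i).card else v (S i).card := by
  have hm : ∀ m : ℕ, ∃ uv : ℝ × ℝ, ∀ i, (S i).card = m → ∀ k,
      ceLoss (fun k => (W * H) k i + b k) k = if k ∈ S i then uv.1 else uv.2 := by
    intro m
    by_cases h : ∃ i, (S i).card = m
    · obtain ⟨i₀, hi₀⟩ := h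
      obtain ⟨k₀, hk₀⟩ := hne i₀
      obtain ⟨l₀, hl₀⟩ : ∃ l, l ∉ S i₀ := by
        by_contra! hall
        exact hproper i₀ (Finset.eq_univ_of_forall hall)
      refine ⟨(ceLoss (fun k => (W * H) k i₀ + b k) k₀, ceLoss (fun k => (W * H) k i₀ + b k) l₀),
        fun i hi k => ?_⟩
      split_ifs with hk
      · exact hmin.ceLoss_eq_of_card_eq hN hd hne hbal hlW hlH hlb (hi.trans hi₀.symm) (by tauto)
      · exact hmin.ceLoss_eq_of_card_eq hN hd hne hbal hlW hlH hlb (hi.trans hi₀.symm) (by tauto)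
    · exact ⟨0, fun i hi => absurd ⟨i, hi⟩ h⟩
  choose uv huv using hm
  exact ⟨fun m => (uv m).1, fun m => (uv m).2, fun i k => huv _ i rfl k⟩

/-- The loss gradients and the logits at a global minimizer are multiples of (centred) label
indicators, with factors depending on the multiplicity only. -/
lemma IsGlobalMin.exists_gradient_profile (hN : 0 < N) (hd : K ≤ d + 1)
    (hne : ∀ i, (S i).Nonempty) (hproper : ∀ i, S i ≠ Finset.univ)
    (hbal : BalancedWithinMultiplicity S)
    (hlW : 0 < lamW) (hlH : 0 < lamH) (hlb : 0 ≤ lamb)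
    (hmin : IsGlobalMin S lamW lamH lamb W H b) :
    ∃ g a : ℕ → ℝ, (∀ m, 0 < g m) ∧
      (∀ i k, (if k ∈ S i then 1 else 0) -
        (S i).card * Real.exp (-ceLoss (fun k => (W * H) k i + b k) k) =
          g (S i).card * centredIndicator (S i) k) ∧
      ∀ i, ∃ c : ℝ, ∀ k, (W * H) k i + b k = a (S i).card * (if k ∈ S i then 1 else 0) + c := by
  obtain ⟨u, v, huv⟩ := hmin.exists_ceLoss_profile hN hd hne hproper hbal hlW hlH hlb
  -- Here `g m` is the softmax probability of an absent label. As probabilities sum to one, `1 - m *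
  -- exp (-u m) = (K - m) * exp (-v m)`, which is the gradient on a present label.
  refine ⟨fun m => Real.exp (-v m), fun m => v m - u m, fun m => Real.exp_pos _, ?_, ?_⟩
  · intro i k
    have hs := sum_exp_neg_ceLoss (fun k => (W * H) k i + b k) k
    have hexp : ∀ l, Real.exp (-ceLoss (fun k => (W * H) k i + b k) l) =
        Real.exp (-v (S i).card) + (if l ∈ S i then 1 else 0) *
          (Real.exp (-u (S i).card) - Real.exp (-v (S i).card)) := fun l => by
      rw [huv]
      split_ifs <;> ring
    simp only [hexp, Finset.sum_add_distrib, ← Finset.sum_mul] at hs ⊢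
    simp at hs
    unfold centredIndicator
    split_ifs
    · linarith
    · ring
  · intro i
    refine ⟨Real.log (∑ l, Real.exp ((W * H) l i + b l)) - v (S i).card, fun k => ?_⟩
    have h := huv i k
    rw [ceLoss_eq] at h
    split_ifs at h ⊢ <;> linarith

/-- Perturb one entry of `H`. The constant part of the centred indicator drops out because the
columns of `W` sum to zero. -/
lemma IsGlobalMin.features_eq (hN : 0 < N) (hne : ∀ i, (S i).Nonempty) (hlW : 0 < lamW)
    (hlH : 0 < lamH) (hmin : IsGlobalMin S lamW lamH lamb W H b) {g : ℕ → ℝ}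
    (hg : ∀ i k, (if k ∈ S i then 1 else 0) -
      (S i).card * Real.exp (-ceLoss (fun k => (W * H) k i + b k) k) =
        g (S i).card * centredIndicator (S i) k) (j : Fin d) (i : Fin N) :
    H j i = g (S i).card * K / (2 * N * lamH) * ∑ k ∈ S i, W k j := by
  have h := hmin.stationary hN hne (Matrix.single j i 1) 0
  have hN' : (0 : ℝ) < N := by exact_mod_cast hN
  simp only [hg] at h
  have hR : ∑ j', ∑ i', H j' i' * Matrix.single j i (1 : ℝ) j' i' = H j i := by
    rw [Finset.sum_eq_single_of_mem j (Finset.mem_univ _) (fun j' _ hj' => by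
      simp [hj'.symm]),
      Finset.sum_eq_single_of_mem i (Finset.mem_univ _) (fun i' _ hi' => by
      simp [hi'.symm])]
    simp
  have hL : ∑ i', ∑ k, g (S i').card * centredIndicator (S i') k *
      ((W * Matrix.single j i (1 : ℝ)) k i' + (0 : Fin K → ℝ) k) =
      g (S i).card * K * ∑ k ∈ S i, W k j := by
    rw [Finset.sum_eq_single_of_mem i (Finset.mem_univ _) (fun i' _ hi' => by
      simp [Matrix.mul_single_apply_of_ne _ _ _ _ _ hi'])]
    simp only [Matrix.mul_single_apply_same, mul_one, Pi.zero_apply, add_zero, mul_assoc,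
      ← Finset.mul_sum]
    simp only [centredIndicator, sub_mul, Finset.sum_sub_distrib, ← Finset.mul_sum, mul_assoc,
      ite_mul, one_mul, zero_mul, Finset.sum_ite_mem, Finset.univ_inter,
      hmin.colSum_eq_zero hlW j]
    ring
  rw [hL, hR] at h
  simp only [Pi.zero_apply, mul_zero, Finset.sum_const_zero, add_zero] at h
  field_simp
  linarith

lemma IsGlobalMin.lamb_mul_bias_eq_zero (hN : 0 < N) (hne : ∀ i, (S i).Nonempty)
    (hbal : BalancedWithinMultiplicity S)
    (hmin : IsGlobalMin S lamW lamH lamb W H b) {g : ℕ → ℝ}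
    (hg : ∀ i k, (if k ∈ S i then 1 else 0) -
      (S i).card * Real.exp (-ceLoss (fun k => (W * H) k i + b k) k) =
        g (S i).card * centredIndicator (S i) k) (k : Fin K) :
    lamb * b k = 0 := by
  have h := hmin.stationary hN hne 0 (Pi.single k 1)
  have hN' : (N : ℝ) ≠ 0 := by positivity
  simp only [hg] at h
  simpa [Pi.single_apply, hbal.sum_centredIndicator_eq_zero, hN'] using h

lemma sum_features_eq_zero (hbal : BalancedWithinMultiplicity S) (hW : ∀ j, ∑ k, W k j = 0)
    (hK : 0 < K) {C : ℕ → ℝ} (hH : ∀ j i, H j i = C (S i).card * ∑ k ∈ S i, W k j)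
    (j : Fin d) : ∑ i, H j i = 0 := by
  have hK' : (K : ℝ) ≠ 0 := by positivity
  have h : ∀ i, H j i = (∑ k, C (S i).card * centredIndicator (S i) k * W k j) / K := fun i => by
    simp only [hH, mul_assoc, ← Finset.mul_sum]
    simp only [centredIndicator, sub_mul, Finset.sum_sub_distrib, ← Finset.mul_sum, mul_assoc,
      ite_mul, one_mul, zero_mul, Finset.sum_ite_mem, Finset.univ_inter, hW j]
    field_simp
    ring
  simp only [h, ← Finset.sum_div]
  rw [Finset.sum_comm]
  simp [← Finset.sum_mul, hbal.sum_centredIndicator_eq_zero]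

lemma sum_indicator_eq (hbal : BalancedWithinMultiplicity S) (F : ℕ → ℝ) (k l : Fin K) :
    ∑ i, F (S i).card * (if k ∈ S i then 1 else 0) =
      ∑ i, F (S i).card * (if l ∈ S i then 1 else 0) := by
  have hK : (K : ℝ) ≠ 0 := by have := k.pos; positivity
  have h := (hbal.sum_centredIndicator_eq_zero F k).trans
    (hbal.sum_centredIndicator_eq_zero F l).symm
  simp only [centredIndicator, mul_sub, Finset.sum_sub_distrib, sub_left_inj,
    mul_left_comm _ (K : ℝ), ← Finset.mul_sum] at h
  exact mul_left_cancel₀ hK h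

/-- Summing the logits over all samples kills `W * H`; the remaining indicator sums are independent
of the label by balance. -/
lemma bias_eq (hN : 0 < N) (hbal : BalancedWithinMultiplicity S) (hH : ∀ j, ∑ i, H j i = 0)
    {a : ℕ → ℝ} (ha : ∀ i, ∃ c : ℝ, ∀ k,
      (W * H) k i + b k = a (S i).card * (if k ∈ S i then 1 else 0) + c) (k l : Fin K) :
    b k = b l := by
  choose c hc using ha
  have hN' : (N : ℝ) ≠ 0 := by positivity
  have h : ∀ k, N * b k = ∑ i, a (S i).card * (if k ∈ S i then 1 else 0) + ∑ i, c i := fun k => by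
    have h0 : ∑ i, (W * H) k i = 0 := by
      simp only [Matrix.mul_apply]
      rw [Finset.sum_comm]
      simp [← Finset.mul_sum, hH]
    rw [← Finset.sum_add_distrib, ← Finset.sum_congr rfl fun i _ => hc i k,
      Finset.sum_add_distrib, h0]
    simp
  refine mul_left_cancel₀ hN' ?_
  rw [h, h, sum_indicator_eq hbal a k l]

/-- The Gram matrix of the classifier rows is a multiple of that of a simplex. -/
lemma exists_gram_eq (hN : 0 < N) (hne : ∀ i, (S i).Nonempty)
    (hproper : ∀ i, S i ≠ Finset.univ) (hbal : BalancedWithinMultiplicity S)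
    (hW : ∀ j, ∑ k, W k j = 0) {C : ℕ → ℝ} (hC : ∀ m, 0 < C m)
    (hH : ∀ j i, H j i = C (S i).card * ∑ k ∈ S i, W k j) {β : ℝ} {a : ℕ → ℝ}
    (ha : ∀ i, ∃ c : ℝ, ∀ k,
      (W * H) k i + β = a (S i).card * (if k ∈ S i then 1 else 0) + c) :
    ∃ τ : ℝ, ∀ k l, (W * W.transpose) k l = τ * (K * (if k = l then 1 else 0) - 1) := by
  obtain ⟨t, ht, hmom⟩ := hbal.exists_pos_sum_indicator_mul_centredIndicator hN hne hproper
  obtain ⟨s, hs⟩ := hbal.exists_sum_indicator_mul_centredIndicator fun m => a m / C m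
  choose c hc using ha
  set A := W * W.transpose with hA
  have hsym : ∀ k l, A k l = A l k := fun k l => by
    simp [hA, Matrix.mul_apply, mul_comm]
  have hrow : ∀ k, ∑ l, A k l = 0 := fun k => by
    simp only [hA, Matrix.mul_apply, Matrix.transpose_apply]
    rw [Finset.sum_comm]
    simp [← Finset.mul_sum, hW]
  have hAS : ∀ i k, ∑ l, A k l * (if l ∈ S i then 1 else 0) =
      a (S i).card / C (S i).card * (if k ∈ S i then 1 else 0) + (c i - β) / C (S i).card := by
    intro i k
    have h1 : (W * H) k i = C (S i).card * ∑ l, A k l * (if l ∈ S i then 1 else 0) := by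
      simp only [hA, Matrix.mul_apply, Matrix.transpose_apply, hH, mul_ite, mul_one, mul_zero,
        Finset.sum_ite_mem, Finset.univ_inter, Finset.mul_sum]
      rw [Finset.sum_comm]
      exact Finset.sum_congr rfl fun _ _ => Finset.sum_congr rfl fun _ _ => by ring
    have h2 := hc i k
    have h3 := (hC (S i).card).ne'
    rw [h1] at h2
    field_simp
    linarith
  have hK : ∀ k : Fin K, (K : ℝ) ≠ 0 := fun k => by have := k.pos; positivity
  -- The column sums of `A` vanish, so summing `hAS` over labels determines the additive constant.
  have hconst : ∀ i (k : Fin K), (c i - β) / C (S i).card =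
      -(a (S i).card / C (S i).card * (S i).card / K) := by
    intro i k
    have h0 : ∑ k, ∑ l, A k l * (if l ∈ S i then 1 else 0) = 0 := by
      rw [Finset.sum_comm]
      simp only [← Finset.sum_mul]
      refine Finset.sum_eq_zero fun l _ => ?_
      rw [Finset.sum_congr rfl fun k _ => hsym k l, hrow, zero_mul]
    simp only [hAS, Finset.sum_add_distrib, ← Finset.mul_sum] at h0
    simp only [Finset.sum_ite_mem, Finset.univ_inter, Finset.sum_const, Finset.card_univ,
      Fintype.card_fin, nsmul_eq_mul, mul_one] at h0
    have h1 := hK k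
    rw [eq_neg_iff_add_eq_zero, ← mul_right_inj' h1, mul_zero, ← h0, mul_add,
      mul_div_cancel₀ _ h1]
    ring
  refine ⟨s / (t * K), fun k l => ?_⟩
  -- Evaluate one sum twice: through the moments of the indicators, where zero row sums of `A` leave
  -- `t * K * A`, and through `hAS`, where the constants cancel by balance. Since `t > 0`, one can
  -- solve for `A`.
  have hkey : ∑ i, (∑ l', A k l' * (if l' ∈ S i then 1 else 0)) * centredIndicator (S i) l =
      t * K * A k l := by
    simp only [Finset.sum_mul, mul_assoc]
    rw [Finset.sum_comm]
    simp only [← Finset.mul_sum, hmom]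
    simp only [mul_sub, mul_one, Finset.sum_sub_distrib, ← Finset.sum_mul, hrow]
    simp
    ring
  have hkey' : ∑ i, (∑ l', A k l' * (if l' ∈ S i then 1 else 0)) * centredIndicator (S i) l =
      s * (K * (if k = l then 1 else 0) - 1) := by
    simp only [hAS, add_mul, Finset.sum_add_distrib, hs, hconst _ k]
    rw [hbal.sum_centredIndicator_eq_zero (fun m => -(a m / C m * m / K)) l, add_zero]
  have h := hkey.symm.trans hkey'
  have h1 := hK k
  have h2 := ht.ne'
  rw [div_mul_eq_mul_div, ← h]
  field_simp

end Structure

end MLabNC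

theorem theorem1 (K d N : ℕ) (hN : 0 < N) (hd : (K : ℤ) - 1 ≤ (d : ℤ))
    (S : Fin N → Finset (Fin K))
    (hne : ∀ i, (S i).Nonempty) (hproper : ∀ i, S i ≠ Finset.univ)
    (hbal : MLabNC.BalancedWithinMultiplicity S)
    (lamW lamH lamb : ℝ) (hW : 0 < lamW) (hH : 0 < lamH) (hb : 0 ≤ lamb)
    (W : Matrix (Fin K) (Fin d) ℝ) (H : Matrix (Fin d) (Fin N) ℝ) (b : Fin K → ℝ)
    (hmin : MLabNC.IsGlobalMin S lamW lamH lamb W H b) :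
    -- equal row norms, constant bias, and the simplex ETF (if `W` does not vanish)
    (∃ w : ℝ, (∀ k, MLabNC.rowNorm W k = w) ∧
      (W ≠ 0 → 0 < w ∧
        ∀ U : Matrix (Fin d) (Fin d) ℝ, U.transpose * U = 1 →
          ((1 / w) • (U * W.transpose)).transpose * ((1 / w) • (U * W.transpose)) =
            ((K : ℝ) / ((K : ℝ) - 1)) •
              ((1 : Matrix (Fin K) (Fin K) ℝ) - (1 / (K : ℝ)) • Matrix.of (fun _ _ => (1 : ℝ))))) ∧
    (∃ β : ℝ, (∀ k, b k = β) ∧ (β = 0 ∨ lamb = 0)) ∧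
    -- the tag-wise average property; if `W` does not vanish, the coefficient of every
    -- multiplicity that occurs in the data is unique
    (∃ C : ℕ → ℝ, (∀ m, 1 ≤ m → m ≤ MLabNC.maxMultiplicity S → 0 < C m) ∧
      MLabNC.TagwiseAverage S W H C ∧
      (W ≠ 0 → ∀ C' : ℕ → ℝ, MLabNC.TagwiseAverage S W H C' →
        ∀ i, C' (S i).card = C (S i).card)) := by
  have hd' : K ≤ d + 1 := by omega
  have hN' : (0 : ℝ) < N := by exact_mod_cast hN
  obtain ⟨k₀, hk₀⟩ := hne ⟨0, hN⟩
  have hKpos : (0 : ℝ) < K := by exact_mod_cast k₀.pos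
  have hcard : ∀ i, ((S i).card : ℝ) < K := fun i => by
    have h := Finset.card_lt_card (Finset.ssubset_univ_iff.2 (hproper i))
    rw [Finset.card_univ, Fintype.card_fin] at h
    exact_mod_cast h
  have hK1 : (0 : ℝ) < K - 1 := by
    have h1 : (1 : ℝ) ≤ (S ⟨0, hN⟩).card := by exact_mod_cast (hne ⟨0, hN⟩).card_pos
    linarith [hcard ⟨0, hN⟩]
  have hcol := hmin.colSum_eq_zero hW
  obtain ⟨g, a, hgpos, hg, ha⟩ := hmin.exists_gradient_profile hN hd' hne hproper hbal hW hH hb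
  set C : ℕ → ℝ := fun m => g m * K / (2 * N * lamH)
  have hC : ∀ m, 0 < C m := fun m => by
    have := hgpos m
    positivity
  have hfeat : ∀ j i, H j i = C (S i).card * ∑ k ∈ S i, W k j :=
    fun j i => hmin.features_eq hN hne hW hH hg j i
  have hbias : ∀ k, b k = b k₀ := fun k =>
    MLabNC.bias_eq hN hbal (MLabNC.sum_features_eq_zero hbal hcol k₀.pos hfeat) ha k k₀
  obtain ⟨τ, hτ⟩ := MLabNC.exists_gram_eq hN hne hproper hbal hcol hC hfeat (β := b k₀) (a := a)
    (fun i => by simpa only [hbias] using ha i)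
  have hnorm : ∀ k, MLabNC.rowNorm W k ^ 2 = τ * (K - 1) := fun k => by
    have h := hτ k k
    rw [if_pos rfl, mul_one] at h
    rw [← h, MLabNC.rowNorm, EuclideanSpace.real_norm_sq_eq, Matrix.mul_apply]
    exact Finset.sum_congr rfl fun j _ => by rw [Matrix.transpose_apply, sq]
  have hτpos : W ≠ 0 → 0 < τ := fun hW0 => by
    by_contra! hle
    apply hW0
    ext k j
    have h1 : MLabNC.rowNorm W k = 0 := by
      refine pow_eq_zero_iff two_ne_zero |>.1 (le_antisymm ?_ (sq_nonneg _))
      rw [hnorm]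
      exact mul_nonpos_of_nonpos_of_nonneg hle hK1.le
    have h2 : WithLp.toLp 2 (W k) = 0 := norm_eq_zero.1 h1
    simpa using congrArg (fun x : EuclideanSpace ℝ (Fin d) => x j) h2
  refine ⟨⟨√(τ * (K - 1)), fun k => ?_, fun hW0 => ⟨?_, fun U hU => ?_⟩⟩,
    ⟨b k₀, hbias, ?_⟩, C, fun m _ _ => hC m, ⟨fun i k hi => ?_, fun i m _ hi => ?_⟩,
    fun hW0 C' hC' i => ?_⟩
  · rw [← hnorm k]
    exact (Real.sqrt_sq (norm_nonneg _)).symm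
  · exact Real.sqrt_pos.2 (mul_pos (hτpos hW0) hK1)
  · have hpos := mul_pos (hτpos hW0) hK1
    have hτ0 := (hτpos hW0).ne'
    have hw : 1 / √(τ * (K - 1)) * (1 / √(τ * (K - 1))) = 1 / (τ * (K - 1)) := by
      rw [div_mul_div_comm, one_mul, Real.mul_self_sqrt hpos.le]
    rw [Matrix.transpose_smul, Matrix.smul_mul, Matrix.mul_smul, smul_smul, hw,
      Matrix.transpose_mul, Matrix.transpose_transpose, Matrix.mul_assoc,
      ← Matrix.mul_assoc U.transpose, hU, Matrix.one_mul]
    ext k l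
    simp only [Matrix.smul_apply, hτ, Matrix.sub_apply, Matrix.one_apply, Matrix.of_apply,
      smul_eq_mul]
    field_simp
  · rcases mul_eq_zero.1 (hmin.lamb_mul_bias_eq_zero hN hne hbal hg k₀) with h | h
    · exact Or.inr h
    · exact Or.inl h
  · ext j
    have h := hfeat j i
    rw [hi, Finset.card_singleton, Finset.sum_singleton] at h
    simpa using h
  · ext j
    have h := hfeat j i
    rw [hi] at h
    simpa [Finset.sum_apply] using h
  · have hmean : ∀ j, H j i = C' (S i).card * ∑ k ∈ S i, W k j := by
      intro j
      rcases (Nat.one_le_iff_ne_zero.2 (hne i).card_pos.ne').eq_or_lt with h1 | h1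
      · obtain ⟨k, hk⟩ := Finset.card_eq_one.1 h1.symm
        have h := congrFun (hC'.1 i k hk) j
        rw [hk, Finset.card_singleton, Finset.sum_singleton]
        simpa using h
      · simpa [Finset.sum_apply] using congrFun (hC'.2 i _ h1 rfl) j
    -- Two different coefficients would force the rows over `S i` to sum to zero. Pairing that sum
    -- with a row of `S i` gives `τ * (K - |S i|) = 0`, impossible for a proper label set.
    by_contra hCC
    have hzero : ∀ j, ∑ l ∈ S i, W l j = 0 := fun j => by
      have h := (hmean j).symm.trans (hfeat j i)
      by_contra h0
      exact hCC (mul_right_cancel₀ h0 h)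
    obtain ⟨k, hk⟩ := hne i
    have h1 : ∑ l ∈ S i, (W * W.transpose) k l = 0 := by
      simp only [Matrix.mul_apply, Matrix.transpose_apply]
      rw [Finset.sum_comm]
      simp [← Finset.mul_sum, hzero]
    simp only [hτ, ← Finset.mul_sum, Finset.sum_sub_distrib] at h1
    simp [hk] at h1
    rcases h1 with h1 | h1
    · exact (hτpos hW0).ne' h1
    · linarith [hcard i]
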